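/- Let $\Sigma=\{\mathtt a,\mathtt b\}$. A word $w\in\Sigma^*$ is strictly balanced if it contains as many $\mathtt a$s as $\mathtt b$s. A word $u$ is a scattered factor of $w$ if $u$ is obtained from $w$ by deleting some (possibly none) of its letters, and the $k$-spectrum $\mathrm{ScatFact}_k(w)$ is the set (without multiplicities) of all scattered factors of $w$ of length $k$. Theorem. Let $k\ge 5$ be an integer. There is no strictly balanced word $w$ of length $2k$ with $|\mathrm{ScatFact}_k(w)|=2k+i$ for some $i\in\{1,\dots,k-4\}$. In other words, none of the numbers $2k+1,\dots,3k-4$ belongs to the set $$C_k=\{\,|\mathrm{ScatFact}_k(w)| : w\in\Sigma^{2k}\text{ strictly balanced}\,\}.$$ Moreover, $3k-3$ is the third smallest element of $C_k$: one has $3k-3\in C_k$, and the elements of $C_k$ smaller than $3k-3$ are exactly $k+1$ and $2k$. -/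

import Mathlib

namespace ScatFact

/-- The letters of the binary alphabet `{a, b}`: `a` is `false` and `b` is `true`. -/
abbrev Letter : Type := Bool

/-- The letter `a`. -/
abbrev Letter.a : Letter := false

/-- The letter `b`. -/
abbrev Letter.b : Letter := true

/-- Finite words over the binary alphabet. -/
abbrev Word : Type := List Letter

/-- A word is `c`-balanced if the numbers of its `a`s and of its `b`s differ by exactly `c`. -/
def IsBalanced (c : ℕ) (w : Word) : Prop :=
  |((w.count Letter.a : ℕ) : ℤ) - ((w.count Letter.b : ℕ) : ℤ)| = (c : ℤ)

/-- Strictly balanced words are the `0`-balanced words. -/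
def IsStrictlyBalanced (w : Word) : Prop := IsBalanced 0 w

/-- `u` is a scattered factor of `w` if it arises from `w` by deleting letters,
that is, if `u` is a (not necessarily contiguous) subsequence of `w`. -/
def IsScatteredFactor (u w : Word) : Prop := List.Sublist u w

/-- The `k`-spectrum of `w`: the set (without multiplicities) of the scattered factors of `w`
of length `k`. -/
def spectrum (k : ℕ) (w : Word) : Set Word :=
  {u | IsScatteredFactor u w ∧ u.length = k}

theorem spectrum_eq_toFinset (k : ℕ) (w : Word) :
    spectrum k w = ((w.sublistsLen k).toFinset : Set Word) := by
  ext u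
  simp [spectrum, IsScatteredFactor, List.mem_sublistsLen]

/-- Spectra are finite, so that `Set.ncard` is their true cardinality. -/
theorem spectrum_finite (k : ℕ) (w : Word) : (spectrum k w).Finite := by
  rw [spectrum_eq_toFinset]
  exact Finset.finite_toSet _

/-- The cardinalities of the `k`-spectra of the strictly balanced words of length `2k`. -/
def spectrumCardinalities (k : ℕ) : Set ℕ :=
  {n | ∃ w : Word, IsStrictlyBalanced w ∧ w.length = 2 * k ∧ (spectrum k w).ncard = n}

end ScatFact

namespace ScatFact

open List

/-! Write `d` for the other letter and `w = c^x d v`. Removing the leading `c`s one at a time splits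
the spectrum by first letter. Each removal contributes a spectrum of `v`, which holds a word for
each possible number of `c`s. Summing gives `(x+1)(k-x+1) ≤ |ScatFact_k(w)|`
(`mul_le_ncard_spectrum`), and this is at least `3k-3` for `2 ≤ x ≤ k-2`. The remaining first runs
are `x = k` (cardinality `k+1`), `x = k-1` (`2k`, or at least `3k-3`) and `x = 1`, handled by
stripping a letter or by reversal. The words `c^i d^k c^(k-i)` attain the bound and realise `k+1`,
`2k` and `3k-3` for `i = 0, 1, 2`. -/

theorem length_eq_count_add_count (c : Letter) (w : Word) :
    w.length = w.count c + w.count (!c) := by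
  rw [count_add_count_not]

theorem eq_replicate_of_count_not_eq_zero {c : Letter} {w : Word} (h : w.count (!c) = 0) :
    w = replicate (w.count c) c := by
  have hl := length_eq_count_add_count c w
  rw [h, add_zero] at hl
  rw [← hl, eq_replicate_iff]
  refine ⟨rfl, fun b hb => ?_⟩
  by_contra hbc
  have : b = !c := by cases b <;> cases c <;> simp_all
  subst this
  exact (count_eq_zero.1 h) hb

/-- A word is a run of a letter, possibly followed by the other letter. -/
theorem exists_first_run (c : Letter) (w : Word) :
    (∃ x, w = replicate x c) ∨ ∃ x v, w = replicate x c ++ (!c) :: v := by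
  induction w with
  | nil => exact Or.inl ⟨0, rfl⟩
  | cons d w ih =>
    by_cases hd : d = c
    · subst hd
      rcases ih with ⟨x, rfl⟩ | ⟨x, v, rfl⟩
      · exact Or.inl ⟨x + 1, rfl⟩
      · exact Or.inr ⟨x + 1, v, rfl⟩
    · have : d = !c := by cases d <;> cases c <;> simp_all
      subst this
      exact Or.inr ⟨0, w, rfl⟩

theorem exists_sublist_count (c : Letter) (w : Word) (p q : ℕ) (hp : p ≤ w.count c)
    (hq : q ≤ w.count (!c)) : ∃ u, List.Sublist u w ∧ u.count c = p ∧ u.count (!c) = q := by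
  induction w generalizing p q with
  | nil =>
    simp only [count_nil, nonpos_iff_eq_zero] at hp hq
    exact ⟨[], Sublist.refl _, by simp [hp], by simp [hq]⟩
  | cons d w ih =>
    by_cases hd : d = c
    · subst hd
      have hq' : q ≤ w.count (!d) := by simpa [count_cons] using hq
      rcases p with _ | p
      · obtain ⟨u, hu, h1, h2⟩ := ih 0 q (Nat.zero_le _) hq'
        exact ⟨u, hu.cons _, h1, h2⟩
      · obtain ⟨u, hu, h1, h2⟩ := ih p q (by simpa using hp) hq'
        exact ⟨d :: u, hu.cons_cons _, by simp [h1], by simp [h2]⟩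
    · have : d = !c := by cases d <;> cases c <;> simp_all
      subst this
      have hp' : p ≤ w.count c := by simpa [count_cons] using hp
      rcases q with _ | q
      · obtain ⟨u, hu, h1, h2⟩ := ih p 0 hp' (Nat.zero_le _)
        exact ⟨u, hu.cons _, h1, h2⟩
      · obtain ⟨u, hu, h1, h2⟩ := ih p q hp' (by simpa using hq)
        exact ⟨(!c) :: u, hu.cons_cons _, by simp [h1], by simp [h2]⟩

/-! ### Lower bounds for spectra. -/

/-- Scattered factors with different numbers of occurrences of a letter are different. -/
theorem min_count_add_one_le_ncard_spectrum (c : Letter) (m : ℕ) (w : Word)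
    (hm : m ≤ w.count (!c)) : min (w.count c) m + 1 ≤ (spectrum m w).ncard := by
  have hsub : Set.Iic (min (w.count c) m) ⊆ (fun u : Word => u.count c) '' spectrum m w := by
    intro p hp
    simp only [Set.mem_Iic, le_min_iff] at hp
    obtain ⟨u, hu, h1, h2⟩ := exists_sublist_count c w p (m - p) hp.1 (by omega)
    refine ⟨u, ⟨hu, ?_⟩, h1⟩
    have := length_eq_count_add_count c u
    omega
  have hcard := (Set.ncard_le_ncard hsub ((spectrum_finite m w).image _)).trans
    (Set.ncard_image_le (spectrum_finite m w))
  have hI : (Set.Iic (min (w.count c) m)).ncard = min (w.count c) m + 1 := by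
    rw [← Finset.coe_Iic, Set.ncard_coe_finset, Nat.card_Iic]
  omega

/-- Splitting a spectrum according to the first letter of the scattered factors. -/
theorem ncard_spectrum_succ (c : Letter) (m x : ℕ) (v : Word) :
    (spectrum (m + 1) (replicate (x + 1) c ++ (!c) :: v)).ncard =
      (spectrum m (replicate x c ++ (!c) :: v)).ncard + (spectrum m v).ncard := by
  have hsplit : spectrum (m + 1) (replicate (x + 1) c ++ (!c) :: v) =
      List.cons c '' spectrum m (replicate x c ++ (!c) :: v) ∪
        List.cons (!c) '' spectrum m v := by
    ext u
    constructor
    · rintro ⟨hu, hl⟩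
      rcases u with _ | ⟨d, u⟩
      · simp at hl
      · by_cases hd : d = c
        · subst hd
          refine Or.inl ⟨u, ⟨?_, by simpa using hl⟩, rfl⟩
          simpa [IsScatteredFactor, replicate_succ] using hu
        · have : d = !c := by cases d <;> cases c <;> simp_all
          subst this
          refine Or.inr ⟨u, ⟨?_, by simpa using hl⟩, rfl⟩
          -- A leading `!c` cannot be matched inside the run of `c`s, so the rest embeds in `v`.
          have key : ∀ y, List.Sublist ((!c) :: u) (replicate y c ++ (!c) :: v) →
              List.Sublist u v := by
            intro y
            induction y with
            | zero => simp
            | succ y ih =>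
              intro h
              rw [replicate_succ, cons_append] at h
              rcases cons_sublist_cons'.1 h with h | ⟨h, _⟩
              · exact ih h
              · simp at h
          exact key _ hu
    · rintro (⟨u, ⟨hu, hl⟩, rfl⟩ | ⟨u, ⟨hu, hl⟩, rfl⟩)
      · exact ⟨by simpa [IsScatteredFactor, replicate_succ] using hu, by simp [hl]⟩
      · exact ⟨(List.Sublist.cons_cons _ hu).trans (sublist_append_right _ _), by simp [hl]⟩
  rw [hsplit, Set.ncard_union_eq _ ((spectrum_finite _ _).image _) ((spectrum_finite _ _).image _),
    Set.ncard_image_of_injective _ (List.cons_injective),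
    Set.ncard_image_of_injective _ (List.cons_injective)]
  rw [Set.disjoint_left]
  rintro _ ⟨u, _, rfl⟩ ⟨u', _, h⟩
  simp at h

theorem ncard_spectrum_reverse (m : ℕ) (w : Word) :
    (spectrum m w.reverse).ncard = (spectrum m w).ncard := by
  have : spectrum m w.reverse = List.reverse '' spectrum m w := by
    ext u
    constructor
    · rintro ⟨hu, hl⟩
      refine ⟨u.reverse, ⟨?_, by simpa using hl⟩, by simp⟩
      simpa [IsScatteredFactor] using List.Sublist.reverse hu
    · rintro ⟨u, ⟨hu, hl⟩, rfl⟩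
      exact ⟨List.Sublist.reverse hu, by simpa using hl⟩
  rw [this, Set.ncard_image_of_injective _ List.reverse_injective]

/-- Each letter of the run adds a spectrum of `v`; `hv` leaves enough `!c`s in `v` to pad words with
any number of `c`s to the required length. -/
theorem mul_le_ncard_spectrum_of_first_run (c : Letter) (x : ℕ) (v : Word)
    (hv : v.count c + x ≤ v.count (!c) + 1) :
    (x + 1) * (v.count c + 1) ≤
      (spectrum (v.count c + x) (replicate x c ++ (!c) :: v)).ncard := by
  induction x with
  | zero =>
    have := min_count_add_one_le_ncard_spectrum c (v.count c) ((!c) :: v) (by simpa using hv)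
    simpa [count_cons] using this
  | succ x ih =>
    have h1 := ih (by omega)
    have h2 := min_count_add_one_le_ncard_spectrum c (v.count c + x) v (by omega)
    rw [min_eq_left (by omega)] at h2
    rw [← add_assoc, ncard_spectrum_succ]
    linarith

/-- The lower bound for balanced words in terms of the length of the first run. -/
theorem mul_le_ncard_spectrum (c : Letter) (k x : ℕ) (v w : Word)
    (hw : w = replicate x c ++ (!c) :: v) (hc : w.count c = k) (hn : w.count (!c) = k) :
    (x + 1) * (k - x + 1) ≤ (spectrum k w).ncard := by
  subst hw
  simp [count_replicate] at hc hn
  have := mul_le_ncard_spectrum_of_first_run c x v (by omega)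
  rwa [show v.count c + x = k by omega, show v.count c = k - x by omega] at this

/-! ### Words with exactly known spectra. -/

/-- Once the length is fixed, the numbers of `c`s taken from the two outer runs determine the
factor. -/
theorem ncard_spectrum_three_runs_le (c : Letter) (m i n j : ℕ) :
    (spectrum m (replicate i c ++ replicate n (!c) ++ replicate j c)).ncard ≤
      (i + 1) * (j + 1) := by
  have hsub : spectrum m (replicate i c ++ replicate n (!c) ++ replicate j c) ⊆
      ((Finset.range (i + 1) ×ˢ Finset.range (j + 1)).image (fun p : ℕ × ℕ =>
        replicate p.1 c ++ replicate (m - p.1 - p.2) (!c) ++ replicate p.2 c) :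
          Finset Word) := by
    rintro u ⟨hu, hl⟩
    obtain ⟨u', u₃, rfl, h', h₃⟩ := sublist_append_iff.1 hu
    obtain ⟨u₁, u₂, rfl, h₁, h₂⟩ := sublist_append_iff.1 h'
    obtain ⟨p, hp, rfl⟩ := sublist_replicate_iff.1 h₁
    obtain ⟨q, hq, rfl⟩ := sublist_replicate_iff.1 h₂
    obtain ⟨r, hr, rfl⟩ := sublist_replicate_iff.1 h₃
    simp only [length_append, length_replicate] at hl
    simp only [Finset.coe_image, Set.mem_image, Finset.mem_coe, Finset.mem_product,
      Finset.mem_range]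
    refine ⟨(p, r), ⟨by simp only; omega, by simp only; omega⟩, ?_⟩
    simp only
    rw [show m - p - r = q by omega]
  refine (Set.ncard_le_ncard hsub (Finset.finite_toSet _)).trans ?_
  rw [Set.ncard_coe_finset]
  refine Finset.card_image_le.trans ?_
  simp

/-- With `d = !c`, every factor is one of the `k+1` words `c^i d^(k-i)` or one of the `k-1` words
`c^i d c d^(k-2-i)`. -/
theorem ncard_spectrum_swapped_le (c : Letter) (k : ℕ) (hk : 2 ≤ k) :
    (spectrum k (replicate (k - 1) c ++ (!c) :: c :: replicate (k - 1) (!c))).ncard ≤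
      2 * k := by
  have hsub : spectrum k (replicate (k - 1) c ++ (!c) :: c :: replicate (k - 1) (!c)) ⊆
      (((Finset.range (k + 1)).image (fun i => replicate i c ++ replicate (k - i) (!c))) ∪
        ((Finset.range (k - 1)).image
          (fun i => replicate i c ++ (!c) :: c :: replicate (k - 2 - i) (!c))) :
            Finset Word) := by
    rintro u ⟨hu, hl⟩
    rw [show (!c) :: c :: replicate (k - 1) (!c) =
      replicate 1 (!c) ++ (replicate 1 c ++ replicate (k - 1) (!c)) by simp] at hu
    obtain ⟨u₁, u', rfl, h₁, h'⟩ := sublist_append_iff.1 hu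
    obtain ⟨u₂, u'', rfl, h₂, h''⟩ := sublist_append_iff.1 h'
    obtain ⟨u₃, u₄, rfl, h₃, h₄⟩ := sublist_append_iff.1 h''
    obtain ⟨p, hp, rfl⟩ := sublist_replicate_iff.1 h₁
    obtain ⟨q, hq, rfl⟩ := sublist_replicate_iff.1 h₂
    obtain ⟨r, hr, rfl⟩ := sublist_replicate_iff.1 h₃
    obtain ⟨s, hs, rfl⟩ := sublist_replicate_iff.1 h₄
    simp only [length_append, length_replicate] at hl
    simp only [Finset.coe_union, Finset.coe_image, Set.mem_union, Set.mem_image, Finset.mem_coe,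
      Finset.mem_range]
    obtain rfl | rfl : q = 0 ∨ q = 1 := by omega
    · refine Or.inl ⟨p + r, by omega, ?_⟩
      rw [show k - (p + r) = s by omega, replicate_add, replicate_zero, nil_append,
        append_assoc]
    · obtain rfl | rfl : r = 0 ∨ r = 1 := by omega
      · refine Or.inl ⟨p, by omega, ?_⟩
        rw [show k - p = 1 + s by omega, replicate_add]
        simp
      · refine Or.inr ⟨p, by omega, ?_⟩
        rw [show k - 2 - p = s by omega]
        simp
  refine (Set.ncard_le_ncard hsub (Finset.finite_toSet _)).trans ?_
  rw [Set.ncard_coe_finset]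
  refine (Finset.card_union_le _ _).trans ?_
  refine (Nat.add_le_add Finset.card_image_le Finset.card_image_le).trans ?_
  simp
  omega

theorem ncard_spectrum_three_runs (c : Letter) (k i : ℕ) (hk : 1 ≤ k) (hi : i ≤ k) :
    (spectrum k (replicate i c ++ replicate k (!c) ++ replicate (k - i) c)).ncard =
      (i + 1) * (k - i + 1) := by
  refine le_antisymm (ncard_spectrum_three_runs_le c k i k (k - i)) ?_
  obtain ⟨n, rfl⟩ : ∃ n, k = n + 1 := ⟨k - 1, by omega⟩
  refine mul_le_ncard_spectrum c (n + 1) i (replicate n (!c) ++ replicate (n + 1 - i) c) _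
    (by simp [replicate_succ]) ?_ ?_
  · simp [count_replicate]; omega
  · simp [count_replicate]

theorem ncard_spectrum_swapped (c : Letter) (k : ℕ) (hk : 2 ≤ k) :
    (spectrum k (replicate (k - 1) c ++ (!c) :: c :: replicate (k - 1) (!c))).ncard =
      2 * k := by
  refine le_antisymm (ncard_spectrum_swapped_le c k hk) ?_
  have := mul_le_ncard_spectrum c k (k - 1) _ _ rfl
    (by simp [count_replicate]; omega :
      (replicate (k - 1) c ++ (!c) :: c :: replicate (k - 1) (!c)).count c = k)
    (by simp [count_replicate]; omega)
  rw [show k - 1 + 1 = k by omega, show k - (k - 1) + 1 = 2 by omega] at this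
  omega

/-! ### Classification by the first run. -/

/-- A lower bound for the word `d c d ^ n c ^ n` with `n = k - 1`. -/
theorem le_ncard_spectrum_pair_append (c : Letter) (n : ℕ) (hn : 1 ≤ n) :
    3 * n ≤ (spectrum (n + 1)
      ((!c) :: c :: (replicate n (!c) ++ replicate n c))).ncard := by
  obtain ⟨p, rfl⟩ : ∃ p, n = p + 1 := ⟨n - 1, by omega⟩
  have h1 := ncard_spectrum_succ (!c) (p + 1) 0 (replicate (p + 1) (!c) ++ replicate (p + 1) c)
  have h2 := ncard_spectrum_succ c p 0 (replicate p (!c) ++ replicate (p + 1) c)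
  simp only [Bool.not_not, zero_add, replicate_one, replicate_zero, nil_append,
    cons_append] at h1 h2
  rw [h1, replicate_succ, cons_append, h2]
  -- Stripping the first two letters leaves three spectra, of at least `p+2`, `p+1` and `p+1` words.
  have h3 := min_count_add_one_le_ncard_spectrum c (p + 1)
    ((!c) :: (replicate p (!c) ++ replicate (p + 1) c)) (by simp [count_replicate])
  have h4 := min_count_add_one_le_ncard_spectrum c p
    ((!c) :: (replicate p (!c) ++ replicate (p + 1) c)) (by simp [count_replicate])
  have h5 := min_count_add_one_le_ncard_spectrum c p
    (replicate p (!c) ++ replicate (p + 1) c) (by simp [count_replicate])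
  simp [count_replicate] at h3 h4 h5
  omega

/-- The bound `(x+1)(k-x+1)` is concave in `x`, with value `3(k-1)` at both `x = 2` and `x = k-2`.
-/
theorem three_mul_sub_three_le_ncard_spectrum (c : Letter) (k x : ℕ) (v w : Word)
    (hw : w = replicate x c ++ (!c) :: v) (hc : w.count c = k) (hn : w.count (!c) = k)
    (hx : 2 ≤ x) (hxk : x + 2 ≤ k) : 3 * k - 3 ≤ (spectrum k w).ncard := by
  refine le_trans ?_ (mul_le_ncard_spectrum c k x v w hw hc hn)
  obtain ⟨y, rfl⟩ := Nat.exists_eq_add_of_le hxk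
  obtain ⟨z, rfl⟩ := Nat.exists_eq_add_of_le hx
  rw [show 2 + z + 2 + y - (2 + z) + 1 = y + 3 by omega]
  have : 3 * (2 + z + 2 + y) ≤ (2 + z + 1) * (y + 3) + 3 := by nlinarith
  omega

/-- Only one `c` is left, so `w = c^(k-1) d^(p+1) c d^q` with `d = !c`; `q = 0` and `p = 0` are the
two words with `2k` factors. -/
theorem ncard_spectrum_of_first_run_eq_pred (c : Letter) (k : ℕ) (hk : 3 ≤ k) (w v : Word)
    (hw : w = replicate (k - 1) c ++ (!c) :: v) (hc : w.count c = k) (hn : w.count (!c) = k) :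
    3 * k - 3 ≤ (spectrum k w).ncard ∨ (spectrum k w).ncard = 2 * k := by
  have hvc : v.count c = 1 := by
    simp [hw] at hc; omega
  have hvn : v.count (!c) = k - 1 := by
    simp [hw, count_replicate] at hn; omega
  rcases exists_first_run (!c) v with ⟨p, rfl⟩ | ⟨p, v', rfl⟩
  · simp [count_replicate] at hvc
  · simp only [Bool.not_not] at *
    simp [count_replicate] at hvc hvn
    have hv' := eq_replicate_of_count_not_eq_zero (c := !c) (w := v') (by simpa using hvc)
    generalize v'.count (!c) = q at *
    subst hv'
    rcases Nat.eq_zero_or_pos q with rfl | hq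
    · right
      have h := ncard_spectrum_three_runs c k (k - 1) (by omega) (by omega)
      have : w = replicate (k - 1) c ++ replicate k (!c) ++ replicate (k - (k - 1)) c := by
        rw [hw, show k - (k - 1) = 1 by omega]
        have : replicate k (!c) = (!c) :: replicate p (!c) := by
          rw [← replicate_succ]; congr 1; omega
        simp [this]
      rw [this, h, show k - (k - 1) + 1 = 2 by omega, show k - 1 + 1 = k by omega]
      omega
    · rcases Nat.eq_zero_or_pos p with rfl | hp
      · right
        have : q = k - 1 := by omega
        subst this
        rw [hw]
        exact ncard_spectrum_swapped c k (by omega)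
      · left
        -- Read backwards, the first run has length `q ≤ k-2`, so only `q = 1` escapes the product
        -- bound.
        have hrev : w.reverse = replicate q (!c) ++ (c :: (replicate (p + 1) (!c) ++
            replicate (k - 1) c)) := by
          rw [hw]
          simp [replicate_succ']
        rw [← ncard_spectrum_reverse]
        rcases Nat.lt_or_ge q 2 with hq2 | hq2
        · have hq1 : q = 1 := by omega
          subst hq1
          have h := le_ncard_spectrum_pair_append c (k - 1) (by omega)
          rw [show k - 1 + 1 = k by omega] at h
          rw [hrev, show p + 1 = k - 1 by omega]
          simp only [replicate_one, cons_append, nil_append]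
          omega
        · refine three_mul_sub_three_le_ncard_spectrum (!c) k q _ w.reverse
            (by rw [hrev, Bool.not_not]) (by simpa using hn) (by simpa using hc) hq2 (by omega)

/-- The classification of small spectra of balanced words whose first run is not a single
letter. -/
theorem ncard_spectrum_of_two_le_first_run (c : Letter) (k : ℕ) (hk : 3 ≤ k) (w : Word)
    (hc : w.count c = k) (hn : w.count (!c) = k) (x : ℕ) (hx : 2 ≤ x) (v : Word)
    (hw : w = replicate x c ++ (!c) :: v) :
    3 * k - 3 ≤ (spectrum k w).ncard ∨ (spectrum k w).ncard = k + 1 ∨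
      (spectrum k w).ncard = 2 * k := by
  have hxk : x + v.count c = k := by
    simpa [hw, count_replicate, count_cons] using hc
  have hvn : v.count (!c) + 1 = k := by
    simpa [hw, count_replicate, count_cons] using hn
  by_cases h1 : x = k
  · right; left
    have hv := eq_replicate_of_count_not_eq_zero (c := !c) (w := v) (by simp; omega)
    have h := ncard_spectrum_three_runs c k k (by omega) le_rfl
    have : w = replicate k c ++ replicate k (!c) ++ replicate (k - k) c := by
      rw [hw, hv, h1, ← replicate_succ, hvn]
      simp
    rw [this, h]
    simp
  · by_cases h2 : x = k - 1
    · subst h2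
      rcases ncard_spectrum_of_first_run_eq_pred c k hk w v hw hc hn with h | h
      · exact Or.inl h
      · exact Or.inr (Or.inr h)
    · exact Or.inl (three_mul_sub_three_le_ncard_spectrum c k x v w hw hc hn hx (by omega))

/-- The classification of small spectra of balanced words. -/
theorem ncard_spectrum_of_balanced (k : ℕ) (hk : 3 ≤ k) (w : Word)
    (hc : ∀ c, w.count c = k) :
    3 * k - 3 ≤ (spectrum k w).ncard ∨ (spectrum k w).ncard = k + 1 ∨
      (spectrum k w).ncard = 2 * k := by
  obtain ⟨c, x, v, hx, hw⟩ : ∃ c x v, 1 ≤ x ∧ w = replicate x c ++ (!c) :: v := by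
    rcases w with _ | ⟨c, w⟩
    · have := hc true
      simp at this
      omega
    · rcases exists_first_run c w with ⟨x, rfl⟩ | ⟨x, v, rfl⟩
      · have := hc (!c)
        simp [count_replicate] at this
        omega
      · exact ⟨c, x + 1, v, by omega, rfl⟩
  rcases Nat.lt_or_ge x 2 with hx2 | hx2
  swap
  · exact ncard_spectrum_of_two_le_first_run c k hk w (hc _) (hc _) x hx2 v hw
  obtain rfl : x = 1 := by omega
  obtain ⟨n, rfl⟩ : ∃ n, k = n + 1 := ⟨k - 1, by omega⟩
  have hv : ∀ d, v.count d = n := by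
    intro d
    have := hc d
    rw [hw] at this
    cases c <;> cases d <;> simpa [count_cons] using this
  obtain ⟨d, y, v', hy, hvy⟩ : ∃ d y v', 1 ≤ y ∧ v = replicate y d ++ (!d) :: v' := by
    rcases v with _ | ⟨d, v⟩
    · have := hv true
      simp at this
      omega
    · rcases exists_first_run d v with ⟨y, rfl⟩ | ⟨y, v', rfl⟩
      · have := hv (!d)
        simp [count_replicate] at this
        omega
      · exact ⟨d, y + 1, v', by omega, rfl⟩
  have hyc : y + v'.count d = n := by
    simpa [hvy, count_replicate, count_cons] using hv d
  have hyn : v'.count (!d) + 1 = n := by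
    simpa [hvy, count_replicate, count_cons] using hv (!d)
  by_cases hyn' : y = n
  -- Here `v` is `d^n (!d)^n`, so the reversal of `w` starts with a run of length at least two.
  · have hv' := eq_replicate_of_count_not_eq_zero (c := !d) (w := v') (by simp; omega)
    rw [← ncard_spectrum_reverse]
    obtain ⟨m, rfl⟩ : ∃ m, n = m + 1 := ⟨n - 1, by omega⟩
    refine ncard_spectrum_of_two_le_first_run (!d) (m + 1 + 1) hk w.reverse (by simp [hc])
      (by simp [hc]) (m + 1) (by omega) (replicate m d ++ [!c, c]) ?_
    rw [hw, hvy, hv', show v'.count (!d) = m by omega, hyn', ← replicate_succ]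
    rw [Bool.not_not, ← cons_append (a := d), ← replicate_succ]
    simp
  · left
    -- Stripping `c` leaves spectra of at least `n+1` and `2n` words, in total `3n+1 = 3k-2`; `2n`
    -- needs `1 ≤ y ≤ n-1`.
    have h1 := mul_le_ncard_spectrum d n y v' v hvy (hv _) (hv _)
    have h2 := min_count_add_one_le_ncard_spectrum c n ((!c) :: v) (by simp [hv])
    have h3 := ncard_spectrum_succ c n 0 v
    simp only [zero_add, replicate_zero, nil_append] at h3
    rw [hw, h3]
    simp [hv] at h2
    have h4 : 2 * n ≤ (y + 1) * (n - y + 1) := by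
      obtain ⟨z, rfl⟩ : ∃ z, n = y + 1 + z := ⟨n - (y + 1), by omega⟩
      rw [show y + 1 + z - y + 1 = z + 2 by omega]
      nlinarith
    omega

/-! ### Transfer to the set of cardinalities. -/

theorem count_eq_of_isStrictlyBalanced {k : ℕ} {w : Word} (hb : IsStrictlyBalanced w)
    (hl : w.length = 2 * k) (c : Letter) : w.count c = k := by
  have h1 := length_eq_count_add_count true w
  simp only [IsStrictlyBalanced, IsBalanced, Letter.a, Letter.b, Nat.cast_zero, abs_eq_zero] at hb
  simp only [Bool.not_true] at h1
  cases c <;> omega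

theorem ncard_three_runs_mem_spectrumCardinalities (k i : ℕ) (hk : 1 ≤ k) (hi : i ≤ k) :
    (i + 1) * (k - i + 1) ∈ spectrumCardinalities k := by
  refine ⟨replicate i true ++ replicate k (!true) ++ replicate (k - i) true, ?_, ?_,
    ncard_spectrum_three_runs true k i hk hi⟩
  · simp only [IsStrictlyBalanced, IsBalanced, Nat.cast_zero, abs_eq_zero]
    simp [count_replicate]
    omega
  · simp
    omega

theorem eq_of_mem_spectrumCardinalities {k n : ℕ} (hk : 3 ≤ k)
    (hn : n ∈ spectrumCardinalities k) : 3 * k - 3 ≤ n ∨ n = k + 1 ∨ n = 2 * k := by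
  obtain ⟨w, hb, hl, rfl⟩ := hn
  exact ncard_spectrum_of_balanced k hk w (count_eq_of_isStrictlyBalanced hb hl)

end ScatFact

theorem mainTheorem8 (k : ℕ) (hk : 5 ≤ k) :
    (¬ ∃ w : ScatFact.Word, ScatFact.IsStrictlyBalanced w ∧ w.length = 2 * k ∧
        ∃ i ∈ Finset.Icc 1 (k - 4), (ScatFact.spectrum k w).ncard = 2 * k + i) ∧
    (∀ n : ℕ, 2 * k + 1 ≤ n → n ≤ 3 * k - 4 → n ∉ ScatFact.spectrumCardinalities k) ∧
    3 * k - 3 ∈ ScatFact.spectrumCardinalities k ∧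
    {n ∈ ScatFact.spectrumCardinalities k | n < 3 * k - 3} = {k + 1, 2 * k} := by
  have hmem := fun n => ScatFact.eq_of_mem_spectrumCardinalities (k := k) (n := n) (by omega)
  refine ⟨?_, ?_, ?_, ?_⟩
  · rintro ⟨w, hb, hl, i, hi, h⟩
    rw [Finset.mem_Icc] at hi
    have := hmem (2 * k + i) ⟨w, hb, hl, h⟩
    omega
  · intro n h1 h2 hn
    have := hmem n hn
    omega
  · have := ScatFact.ncard_three_runs_mem_spectrumCardinalities k 2 (by omega) (by omega)
    rwa [show (2 + 1) * (k - 2 + 1) = 3 * k - 3 by omega] at this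
  · ext n
    simp only [Set.mem_ofPred_eq, Set.mem_insert_iff, Set.mem_singleton_iff]
    constructor
    · rintro ⟨hn, hlt⟩
      have := hmem n hn
      omega
    · rintro (rfl | rfl)
      · have := ScatFact.ncard_three_runs_mem_spectrumCardinalities k 0 (by omega) (by omega)
        rw [show (0 + 1) * (k - 0 + 1) = k + 1 by omega] at this
        exact ⟨this, by omega⟩
      · have := ScatFact.ncard_three_runs_mem_spectrumCardinalities k 1 (by omega) (by omega)
        rw [show (1 + 1) * (k - 1 + 1) = 2 * k by omega] at this
        exact ⟨this, by omega⟩
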